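/- Let $p_Z$ be a probability density function on $\mathbb{R}$ such that, for some $\zeta\in(0,1)$, $$\int_{\mathbb{R}} p_Z(z)\,(\ln p_Z(z))^4\,dz<\infty,\qquad \int_{\mathbb{R}} p_Z(z)^{\zeta}\,dz<\infty,\qquad \int_{\mathbb{R}} p_Z(z)^{\zeta}\,(\ln p_Z(z))^4\,dz<\infty$$ (the integrands are taken to be $0$ where $p_Z(z)=0$). Consider the memoryless additive-noise channel $Y_i=X_i+Z_i$, $i=1,\dots,n$, where $Z_1,\dots,Z_n$ are i.i.d. with density $p_Z$ and independent of the input. A code of length $n$ with finite nonempty message set $\mathcal{M}$ and finite nonempty key set $\mathcal{K}$ consists of an encoder $f:\mathcal{M}\times\mathcal{K}\to\mathbb{R}^n$ and a measurable decoder $g:\mathbb{R}^n\times\mathcal{K}\to\mathcal{M}$. The message and the key are uniformly distributed and independent of each other and of the noise; $X^n=f(m,k)$ is sent when the message is $m$ and the key is $k$, and $P_{Y^n}$ denotes the law of the output $Y^n=X^n+Z^n$ averaged over message and key. Fix $\Delta>0$. For $\epsilon>0$ let $A_n(\Delta,\epsilon)$ be the maximum (supremum) of $\ln|\mathcal{M}|$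 over all codes of length $n$, with key sets of any finite size, such that $D(P_{Y^n}\|P_{Z^n})\le\Delta$ (Kullback–Leibler divergence in nats) and such that the probability of decoding error, averaged over message and key, is at most $\epsilon$. Define $$L=\lim_{\epsilon\downarrow 0}\ \liminf_{n\to\infty}\ \frac{A_n(\Delta,\epsilon)}{\sqrt{n\Delta}} .$$ Then the limit defining $L$ exists in $[-\infty,\infty]$, and $$L\le\sqrt{2}\,\sqrt{\operatorname{Var}[\ln p_Z(Z)]},$$ where $Z$ has density $p_Z$. Moreover, if $p_Z$ is (almost everywhere) the uniform density on a measurable set $\mathcal{S}\subseteq\mathbb{R}$, that is, $1/\lambda(\mathcal{S})$ on $\mathcal{S}$ and $0$ elsewhere, with $\lambda$ Lebesgue measure, then $L=0$. -/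

import Mathlib

open MeasureTheory ProbabilityTheory InformationTheory Filter
open scoped Topology ENNReal

noncomputable section

namespace CovertComm

/-- `p` is a probability density function on `ℝ` with respect to Lebesgue measure. -/
structure IsPDF (p : ℝ → ℝ) : Prop where
  aemeasurable : AEMeasurable p volume
  nonneg : ∀ z, 0 ≤ p z
  lintegral_eq_one : ∫⁻ z, ENNReal.ofReal (p z) = 1

/-- The law `P_Z` of a single noise variable with density `p`. -/
def noise (p : ℝ → ℝ) : Measure ℝ :=
  volume.withDensity fun z => ENNReal.ofReal (p z)

/-- The law `P_{Z^n}` of the i.i.d. noise vector of length `n`. -/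
def noiseVec (p : ℝ → ℝ) (n : ℕ) : Measure (Fin n → ℝ) :=
  Measure.pi fun _ => noise p

/-- The conditional law of the output `Y^n = x^n + Z^n` given the input `X^n = x^n`. -/
def channelLaw (p : ℝ → ℝ) {n : ℕ} (x : Fin n → ℝ) : Measure (Fin n → ℝ) :=
  (noiseVec p n).map fun z => x + z

/-- A deterministic code of length `n` with `M` messages and `K` keys; the key is shared by
the encoder and the decoder. -/
structure Code (n M K : ℕ) where
  enc : Fin M → Fin K → Fin n → ℝ
  dec : (Fin n → ℝ) → Fin K → Fin M
  measurable_dec : ∀ k, Measurable fun y => dec y k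

/-- The law `P_{Y^n}` of the output, averaged over a uniform message and an independent
uniform key. -/
def Code.outputLaw {n M K : ℕ} (c : Code n M K) (p : ℝ → ℝ) : Measure (Fin n → ℝ) :=
  ((K : ℝ≥0∞) * (M : ℝ≥0∞))⁻¹ • ∑ m : Fin M, ∑ k : Fin K, channelLaw p (c.enc m k)

/-- The probability of decoding error, averaged over a uniform message and an independent
uniform key. -/
def Code.avgError {n M K : ℕ} (c : Code n M K) (p : ℝ → ℝ) : ℝ≥0∞ :=
  ((K : ℝ≥0∞) * (M : ℝ≥0∞))⁻¹ *
    ∑ m : Fin M, ∑ k : Fin K, channelLaw p (c.enc m k) {y | c.dec y k ≠ m}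

/-- Covertness: `D(P_{Y^n} ‖ P_{Z^n}) ≤ Δ`, in nats. -/
def Code.IsCovert {n M K : ℕ} (c : Code n M K) (p : ℝ → ℝ) (Δ : ℝ) : Prop :=
  klDiv (c.outputLaw p) (noiseVec p n) ≤ ENNReal.ofReal Δ

/-- `A_n(Δ, ε)`: the largest `ln M` over all codes of length `n` (with any finite nonempty
message and key sets) that are `Δ`-covert and have average error probability at most `ε`. -/
def maxLogMessages (p : ℝ → ℝ) (Δ ε : ℝ) (n : ℕ) : EReal :=
  sSup {a : EReal | ∃ M K : ℕ, 0 < M ∧ 0 < K ∧ a = ((Real.log M : ℝ) : EReal) ∧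
    ∃ c : Code n M K, c.IsCovert p Δ ∧ c.avgError p ≤ ENNReal.ofReal ε}

/-- `liminf_{n → ∞} A_n(Δ, ε) / √(nΔ)`. -/
def scalingAt (p : ℝ → ℝ) (Δ ε : ℝ) : EReal :=
  liminf (fun n : ℕ => maxLogMessages p Δ ε n / ((Real.sqrt (n * Δ) : ℝ) : EReal)) atTop

/-- The square-root scaling constant `L = lim_{ε ↓ 0} liminf_{n → ∞} A_n(Δ, ε) / √(nΔ)`. -/
def scalingConstant (p : ℝ → ℝ) (Δ : ℝ) : EReal :=
  limUnder (𝓝[>] (0 : ℝ)) fun ε => scalingAt p Δ ε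

end CovertComm

end

namespace CovertComm

/-! Everything is read off one statistic, the summed centred self-information `excessSum`, written
Γ, whose mean is zero under pure noise. Covertness keeps its mean under the output small: by
Donsker–Varadhan, t·E[Γ(Y)] ≤ Δ + n ln E[exp(t·excess)], and the last term is n(t²V/2 + O(t³)),
where V = Var[ln p(Z)] (`exists_integrable_majorant_of_klDiv_le`, `integral_exp_mul_le`).
Reliability forces the mean up: Γ(y) - Γ(y - x) is the log-likelihood ratio of the law shifted by x
against pure noise, so a Fano-type change of measure gives (1 - ε) ln M ≤ 1 + E[Γ(Y)]
(`exists_integrable_minorant`, `Code.one_sub_mul_log_le`). With t = s√(nΔ)/n the two bounds give the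
scaling 1/s + sV/2, whose infimum over s is √2·√V. The limit in ε exists by monotonicity. For a
uniform density V = 0, and the one-message code supplies the matching lower bound 0. -/

/-! ### Exponential moments and the Donsker–Varadhan inequality. -/

lemma exp_le_taylor_two (u : ℝ) :
    Real.exp u ≤ 1 + u + u ^ 2 / 2 + |u| ^ 3 * Real.exp u := by
  have hE := Real.exp_pos u
  rcases le_total u 0 with hu | hu
  · have h1 : Real.exp u ≤ 1 + u + u ^ 2 / 2 := by
      have := Real.quadratic_le_exp_of_nonneg (neg_nonneg.2 hu)
      have h2 : Real.exp u * Real.exp (-u) = 1 := by rw [← Real.exp_add]; simp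
      have hq : 0 < 1 + -u + (-u) ^ 2 / 2 := by nlinarith [sq_nonneg u]
      have h3 : Real.exp u * (1 + -u + (-u) ^ 2 / 2) ≤ 1 := by
        exact (mul_le_mul_of_nonneg_left this hE.le).trans h2.le
      by_contra! hlt
      have h4 := mul_lt_mul_of_pos_right hlt hq
      -- (1 + u + u²/2)(1 - u + u²/2) = 1 + u⁴/4 ≥ 1.
      nlinarith [sq_nonneg (u ^ 2)]
    have : 0 ≤ |u| ^ 3 * Real.exp u := by positivity
    linarith
  · rw [abs_of_nonneg hu]
    rcases le_total u 1 with h1 | h1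
    · have := Real.exp_bound' hu h1 (n := 3) (by norm_num)
      simp only [Finset.sum_range_succ, Finset.sum_range_zero, Nat.factorial] at this
      norm_num at this
      have h3 : u ^ 3 * 1 ≤ u ^ 3 * Real.exp u := by gcongr; exact Real.one_le_exp hu
      have h4 : 0 ≤ u ^ 3 := by positivity
      linarith
    · have h3 : 1 * Real.exp u ≤ u ^ 3 * Real.exp u := by gcongr; exact one_le_pow₀ h1
      have : 0 ≤ u ^ 2 := by positivity
      linarith

/-- Gives a majorant independent of t, so the cubic remainder constant is uniform as t → 0. -/
lemma exp_mul_le_one_add_exp_mul {t τ : ℝ} (ht : 0 ≤ t) (htτ : t ≤ τ) (a : ℝ) :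
    Real.exp (t * a) ≤ 1 + Real.exp (τ * a) := by
  rcases le_total a 0 with ha | ha
  · have : Real.exp (t * a) ≤ 1 := Real.exp_le_one_iff.2 (mul_nonpos_of_nonneg_of_nonpos ht ha)
    linarith [Real.exp_pos (τ * a)]
  · have : Real.exp (t * a) ≤ Real.exp (τ * a) := by gcongr
    linarith

/-- One-sided quadratic bound on the moment generating function of a centred variable. -/
lemma integral_exp_mul_le {α : Type*} [MeasurableSpace α] {P : Measure α} [IsProbabilityMeasure P]
    {g : α → ℝ} {τ t : ℝ} (ht : 0 ≤ t) (htτ : t ≤ τ)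
    (hg : Integrable g P) (hg0 : ∫ a, g a ∂P = 0) (hg2 : Integrable (fun a => g a ^ 2) P)
    (hexp : Integrable (fun a => Real.exp (τ * g a)) P)
    (hg3 : Integrable (fun a => |g a| ^ 3 * (1 + Real.exp (τ * g a))) P) :
    Integrable (fun a => Real.exp (t * g a)) P ∧
      ∫ a, Real.exp (t * g a) ∂P ≤ Real.exp (t ^ 2 / 2 * ∫ a, g a ^ 2 ∂P +
        t ^ 3 * ∫ a, |g a| ^ 3 * (1 + Real.exp (τ * g a)) ∂P) := by
  have hint : Integrable (fun a => Real.exp (t * g a)) P := by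
    refine ((integrable_const 1).add hexp).mono' ?_ (ae_of_all _ fun a => ?_)
    · exact Real.continuous_exp.comp_aestronglyMeasurable (hg.aestronglyMeasurable.const_mul t)
    · rw [Real.norm_of_nonneg (Real.exp_pos _).le]
      exact exp_mul_le_one_add_exp_mul ht htτ _
  refine ⟨hint, ?_⟩
  have hpt : ∀ a, Real.exp (t * g a) ≤ 1 + t * g a + t ^ 2 / 2 * g a ^ 2 +
      t ^ 3 * (|g a| ^ 3 * (1 + Real.exp (τ * g a))) := fun a => by
    have h1 := exp_le_taylor_two (t * g a)
    have h2 : |t * g a| ^ 3 * Real.exp (t * g a) ≤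
        t ^ 3 * (|g a| ^ 3 * (1 + Real.exp (τ * g a))) := by
      rw [abs_mul, abs_of_nonneg ht, mul_pow, mul_assoc]
      gcongr
      exact exp_mul_le_one_add_exp_mul ht htτ _
    nlinarith
  have i1 : Integrable (fun a => 1 + t * g a) P := (integrable_const 1).add (hg.const_mul t)
  have i2 : Integrable (fun a => 1 + t * g a + t ^ 2 / 2 * g a ^ 2) P :=
    i1.add (hg2.const_mul _)
  calc ∫ a, Real.exp (t * g a) ∂P
      ≤ ∫ a, (1 + t * g a + t ^ 2 / 2 * g a ^ 2 +
          t ^ 3 * (|g a| ^ 3 * (1 + Real.exp (τ * g a)))) ∂P :=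
        integral_mono hint (i2.add (hg3.const_mul _)) hpt
    _ = 1 + (t ^ 2 / 2 * ∫ a, g a ^ 2 ∂P +
        t ^ 3 * ∫ a, |g a| ^ 3 * (1 + Real.exp (τ * g a)) ∂P) := by
        rw [integral_add i2 (hg3.const_mul _), integral_add i1 (hg2.const_mul _),
          integral_add (integrable_const 1) (hg.const_mul t), integral_const_mul,
          integral_const_mul, integral_const_mul, hg0]
        simp; ring
    _ ≤ _ := by linarith [Real.add_one_le_exp (t ^ 2 / 2 * ∫ a, g a ^ 2 ∂P +
        t ^ 3 * ∫ a, |g a| ^ 3 * (1 + Real.exp (τ * g a)) ∂P)]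

/-- Donsker–Varadhan inequality, with an integrable majorant so that no integrability of `f`
under `μ` has to be assumed. -/
lemma exists_integrable_majorant_of_klDiv_le {α : Type*} [MeasurableSpace α] {μ ν : Measure α}
    [IsProbabilityMeasure μ] [IsProbabilityMeasure ν] {D b : ℝ} (hD : 0 ≤ D)
    (hkl : klDiv μ ν ≤ ENNReal.ofReal D) {f : α → ℝ} (hf : Measurable f)
    (hint : Integrable (fun a => Real.exp (f a)) ν) (hb : ∫ a, Real.exp (f a) ∂ν ≤ Real.exp b) :
    ∃ G : α → ℝ, Integrable G μ ∧ (∀ᵐ a ∂μ, f a ≤ G a) ∧ ∫ a, G a ∂μ ≤ D + b := by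
  obtain ⟨hac, hllr⟩ := klDiv_ne_top_iff.1 (ne_top_of_le_ne_top ENNReal.ofReal_ne_top hkl)
  have hllrD : ∫ a, llr μ ν a ∂μ ≤ D := by
    rw [← toReal_klDiv_of_measure_eq hac (by simp)]
    exact ENNReal.toReal_le_of_le_ofReal hD hkl
  -- Only an inequality: ν may have a part singular to μ.
  have hle : ∫⁻ a, ENNReal.ofReal (Real.exp (f a - b)) * ν.rnDeriv μ a ∂μ ≤ 1 := by
    calc ∫⁻ a, ENNReal.ofReal (Real.exp (f a - b)) * ν.rnDeriv μ a ∂μ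
        = ∫⁻ a, ENNReal.ofReal (Real.exp (f a - b)) ∂(μ.withDensity (ν.rnDeriv μ)) := by
          rw [lintegral_withDensity_eq_lintegral_mul _ (Measure.measurable_rnDeriv _ _)
            (by fun_prop)]
          simp only [Pi.mul_apply, mul_comm]
      _ ≤ ∫⁻ a, ENNReal.ofReal (Real.exp (f a - b)) ∂ν :=
          lintegral_mono' (Measure.withDensity_rnDeriv_le _ _) le_rfl
      _ = ENNReal.ofReal (∫ a, Real.exp (f a - b) ∂ν) := by
          rw [ofReal_integral_eq_lintegral_ofReal _ (ae_of_all _ fun a => (Real.exp_pos _).le)]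
          simpa only [Real.exp_sub] using hint.div_const _
      _ ≤ 1 := by
          simp only [Real.exp_sub, integral_div]
          rw [ENNReal.ofReal_le_one, div_le_one (Real.exp_pos _)]
          exact hb
  set r : α → ℝ := fun a => (ν.rnDeriv μ a).toReal with hr
  have hrm : Measurable r := (Measure.measurable_rnDeriv _ _).ennreal_toReal
  have hlt : ∀ᵐ a ∂μ, ν.rnDeriv μ a < ∞ := Measure.rnDeriv_lt_top ν μ
  have heq : ∫⁻ a, ENNReal.ofReal (Real.exp (f a - b) * r a) ∂μ ≤ 1 := by
    refine le_trans (le_of_eq (lintegral_congr_ae ?_)) hle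
    filter_upwards [hlt] with a ha
    rw [ENNReal.ofReal_mul (Real.exp_pos _).le, ENNReal.ofReal_toReal ha.ne]
  have hnn : ∀ a, 0 ≤ Real.exp (f a - b) * r a := fun a =>
    mul_nonneg (Real.exp_pos _).le ENNReal.toReal_nonneg
  have hme : Measurable fun a => Real.exp (f a - b) * r a := by fun_prop
  have hI : Integrable (fun a => Real.exp (f a - b) * r a) μ := by
    refine ⟨hme.aestronglyMeasurable, ?_⟩
    rw [hasFiniteIntegral_iff_ofReal (ae_of_all _ hnn)]
    exact heq.trans_lt ENNReal.one_lt_top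
  have hI1 : ∫ a, Real.exp (f a - b) * r a ∂μ ≤ 1 := by
    rw [integral_eq_lintegral_of_nonneg_ae (ae_of_all _ hnn) hme.aestronglyMeasurable]
    exact ENNReal.toReal_le_of_le_ofReal zero_le_one (by simpa using heq)
  have hJ : Integrable (fun a => llr μ ν a + Real.exp (f a - b) * r a) μ := hllr.add hI
  -- This is 1 + u ≤ exp u at u = f - b + log r, where log r = -llr; the integral is at most D + 1 +
  -- (b - 1).
  refine ⟨fun a => llr μ ν a + Real.exp (f a - b) * r a + (b - 1),
    hJ.add (integrable_const _), ?_, ?_⟩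
  · filter_upwards [hlt, Measure.rnDeriv_pos' (μ := μ) (ν := ν) hac, neg_llr hac]
      with a h1 h2 h3
    have hr0 : 0 < r a := ENNReal.toReal_pos h2.ne' h1.ne
    have h4 : llr μ ν a = - Real.log (r a) := by
      have : llr μ ν a = - llr ν μ a := by rw [← h3]; simp
      rw [this, llr_def]
    have h5 := Real.add_one_le_exp (f a - b + Real.log (r a))
    rw [Real.exp_add, Real.exp_log hr0] at h5
    linarith
  · rw [integral_add hJ (integrable_const _), integral_add hllr hI]
    simp
    linarith

/-! ### The noise vector and its translates. -/

lemma IsPDF.isProbabilityMeasure {p : ℝ → ℝ} (hp : IsPDF p) : IsProbabilityMeasure (noise p) :=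
  ⟨by rw [noise, withDensity_apply _ MeasurableSet.univ, Measure.restrict_univ,
    hp.lintegral_eq_one]⟩

lemma IsPDF.integrable {p : ℝ → ℝ} (hp : IsPDF p) : Integrable p volume := by
  refine ⟨hp.aemeasurable.aestronglyMeasurable, ?_⟩
  rw [hasFiniteIntegral_iff_ofReal (ae_of_all _ hp.nonneg), hp.lintegral_eq_one]
  exact ENNReal.one_lt_top

lemma noiseVec_eq_withDensity {p : ℝ → ℝ} (hp : IsPDF p) (n : ℕ) :
    noiseVec p n = (volume : Measure (Fin n → ℝ)).withDensity
      fun z => ENNReal.ofReal (∏ i, p (z i)) := by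
  have := hp.isProbabilityMeasure
  refine Measure.pi_eq fun s hs => ?_
  have hind : ∀ i, Integrable ((s i).indicator p) volume := fun i =>
    hp.integrable.indicator (hs i)
  have hnn : ∀ i z, 0 ≤ (s i).indicator p z := fun i z =>
    Set.indicator_nonneg (fun z _ => hp.nonneg z) z
  rw [withDensity_apply _ (MeasurableSet.univ_pi hs), ← lintegral_indicator
    (MeasurableSet.univ_pi hs)]
  have h1 : ∀ z : Fin n → ℝ, (Set.univ.pi s).indicator (fun z => ENNReal.ofReal (∏ i, p (z i))) z
      = ENNReal.ofReal (∏ i, (s i).indicator p (z i)) := fun z => by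
    by_cases hz : z ∈ Set.univ.pi s
    · rw [Set.indicator_of_mem hz]
      congr 1
      exact Finset.prod_congr rfl fun i _ => by
        rw [Set.indicator_of_mem (hz i (Set.mem_univ i))]
    · rw [Set.indicator_of_notMem hz]
      obtain ⟨i, hi⟩ : ∃ i, z i ∉ s i := by simpa [Set.mem_pi] using hz
      rw [Finset.prod_eq_zero (Finset.mem_univ i) (Set.indicator_of_notMem hi _)]
      simp
  simp_rw [h1]
  rw [← ofReal_integral_eq_lintegral_ofReal, integral_fintype_prod_volume_eq_prod,
    ENNReal.ofReal_prod_of_nonneg fun i _ => integral_nonneg (hnn i)]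
  · refine Finset.prod_congr rfl fun i _ => ?_
    rw [ofReal_integral_eq_lintegral_ofReal (hind i) (ae_of_all _ (hnn i)), noise,
      withDensity_apply _ (hs i), ← lintegral_indicator (hs i)]
    refine lintegral_congr fun z => ?_
    by_cases hz : z ∈ s i <;> simp [hz]
  · exact Integrable.fintype_prod hind
  · exact ae_of_all _ fun z => Finset.prod_nonneg fun i _ => hnn i _

/-- Change of measure between the noise law and its translate by `x`. -/
lemma lintegral_translate_mul_ratio_le {p : ℝ → ℝ} (hp : IsPDF p) (hm : Measurable p) {n : ℕ}
    (x : Fin n → ℝ) {F : (Fin n → ℝ) → ℝ≥0∞} (hF : Measurable F) :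
    ∫⁻ z, F (x + z) * ENNReal.ofReal ((∏ i, p (x i + z i)) / ∏ i, p (z i)) ∂(noiseVec p n) ≤
      ∫⁻ y, F y ∂(noiseVec p n) := by
  have hd : Measurable fun z : Fin n → ℝ => ENNReal.ofReal (∏ i, p (z i)) := by fun_prop
  rw [noiseVec_eq_withDensity hp, lintegral_withDensity_eq_lintegral_mul _ hd (by fun_prop),
    lintegral_withDensity_eq_lintegral_mul _ hd hF,
    ← lintegral_add_left_eq_self (μ := (volume : Measure (Fin n → ℝ)))
      ((fun z : Fin n → ℝ => ENNReal.ofReal (∏ i, p (z i))) * F) x]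
  refine lintegral_mono fun z => ?_
  have h0 : 0 ≤ ∏ i, p (z i) := Finset.prod_nonneg fun i _ => hp.nonneg _
  have h1 : 0 ≤ ∏ i, p (x i + z i) := Finset.prod_nonneg fun i _ => hp.nonneg _
  simp only [Pi.mul_apply, Pi.add_apply]
  rw [mul_left_comm, ← ENNReal.ofReal_mul h0, mul_comm]
  gcongr
  rcases h0.eq_or_lt with h | h
  -- Where the noise density vanishes the ratio is 0 by convention; the mass lost there is why only
  -- ≤ holds.
  · simpa [← h] using h1
  · rw [mul_div_cancel₀ _ h.ne']

lemma ae_noiseVec_prod_pos {p : ℝ → ℝ} (hp : IsPDF p) (hm : Measurable p) (n : ℕ) :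
    ∀ᵐ z ∂(noiseVec p n), 0 < ∏ i, p (z i) := by
  rw [noiseVec_eq_withDensity hp, ae_withDensity_iff (by fun_prop)]
  exact ae_of_all _ fun z hz => by simpa using hz

/-! ### The centred self-information and the bound for one codeword. -/

/-- The centred self-information `-ln p(z) - h(Z)`. -/
noncomputable def excess (p : ℝ → ℝ) (z : ℝ) : ℝ := (∫ w, Real.log (p w) ∂noise p) - Real.log (p z)

/-- The centred self-information of a vector. -/
noncomputable def excessSum (p : ℝ → ℝ) {n : ℕ} (y : Fin n → ℝ) : ℝ := ∑ i, excess p (y i)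

lemma measurable_excess {p : ℝ → ℝ} (hm : Measurable p) : Measurable (excess p) := by
  unfold excess; fun_prop

lemma measurable_excessSum {p : ℝ → ℝ} (hm : Measurable p) {n : ℕ} :
    Measurable (excessSum p (n := n)) := by
  have := measurable_excess hm
  unfold excessSum; fun_prop

lemma IsPDF.isProbabilityMeasure_noiseVec {p : ℝ → ℝ} (hp : IsPDF p) (n : ℕ) :
    IsProbabilityMeasure (noiseVec p n) := by
  have := hp.isProbabilityMeasure
  unfold noiseVec; infer_instance

lemma IsPDF.isProbabilityMeasure_channelLaw {p : ℝ → ℝ} (hp : IsPDF p) {n : ℕ} (x : Fin n → ℝ) :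
    IsProbabilityMeasure (channelLaw p x) := by
  have := hp.isProbabilityMeasure_noiseVec n
  exact Measure.isProbabilityMeasure_map (by fun_prop)

lemma integrable_excessSum {p : ℝ → ℝ} (hp : IsPDF p) (hg : Integrable (excess p) (noise p))
    (n : ℕ) : Integrable (excessSum p) (noiseVec p n) := by
  have := hp.isProbabilityMeasure
  exact integrable_finsetSum _ fun i _ => integrable_comp_eval hg

lemma integral_excessSum {p : ℝ → ℝ} (hp : IsPDF p) (hg : Integrable (excess p) (noise p))
    (hg0 : ∫ z, excess p z ∂noise p = 0) (n : ℕ) : ∫ y, excessSum p y ∂noiseVec p n = 0 := by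
  have := hp.isProbabilityMeasure
  unfold excessSum noiseVec
  rw [integral_finsetSum _ fun i _ => integrable_comp_eval hg]
  refine Finset.sum_eq_zero fun i _ => ?_
  exact (integral_comp_eval (μ := fun _ : Fin n => noise p) (f := excess p)
    hg.aestronglyMeasurable).trans hg0

lemma excessSum_eq_sub_log_prod (p : ℝ → ℝ) {n : ℕ} (y : Fin n → ℝ) (h : 0 < ∏ i, p (y i)) :
    excessSum p y = n * (∫ w, Real.log (p w) ∂noise p) - Real.log (∏ i, p (y i)) := by
  rw [Real.log_prod fun i hi h0 => h.ne' (Finset.prod_eq_zero hi h0)]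
  simp [excessSum, excess, Finset.sum_sub_distrib]

/-- A change-of-measure form of Fano's inequality for a single codeword `x` and decision
region `A`, with an integrable minorant of the excess information. -/
lemma exists_integrable_minorant {p : ℝ → ℝ} (hp : IsPDF p) (hm : Measurable p)
    (hg : Integrable (excess p) (noise p)) (hg0 : ∫ z, excess p z ∂noise p = 0) {n : ℕ}
    (x : Fin n → ℝ) (hac : channelLaw p x ≪ noiseVec p n) {A : Set (Fin n → ℝ)}
    (hA : MeasurableSet A) {M : ℝ} (hM : 1 ≤ M) :
    ∃ H : (Fin n → ℝ) → ℝ, Integrable H (channelLaw p x) ∧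
      (∀ᵐ y ∂(channelLaw p x), H y ≤ excessSum p y) ∧
      (channelLaw p x).real A * Real.log M - (M - 1) * (noiseVec p n).real A ≤
        ∫ y, H y ∂(channelLaw p x) := by
  have := hp.isProbabilityMeasure_noiseVec n
  have := hp.isProbabilityMeasure_channelLaw x
  have hxm : Measurable fun z : Fin n → ℝ => x + z := by fun_prop
  have hΓm : Measurable (excessSum p (n := n)) := measurable_excessSum hm
  have hΓs : Measurable fun y : Fin n → ℝ => excessSum p (y - x) :=
    hΓm.comp (by fun_prop)
  have hΓ : Integrable (fun y => excessSum p (y - x)) (channelLaw p x) := by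
    unfold channelLaw
    rw [integrable_map_measure hΓs.aestronglyMeasurable hxm.aemeasurable]
    simpa [Function.comp_def] using integrable_excessSum hp hg n
  have hΓ0 : ∫ y, excessSum p (y - x) ∂(channelLaw p x) = 0 := by
    unfold channelLaw
    rw [integral_map hxm.aemeasurable hΓs.aestronglyMeasurable]
    simpa using integral_excessSum hp hg hg0 n
  -- E is exp(1_A ln M), equal to M on A and 1 elsewhere.
  set E : (Fin n → ℝ) → ℝ := fun y => 1 + A.indicator (fun _ => M - 1) y with hE
  set R : (Fin n → ℝ) → ℝ := fun y => (∏ i, p (y i)) / ∏ i, p (y i - x i) with hR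
  have hEm : Measurable E := measurable_const.add (measurable_const.indicator hA)
  have hRm : Measurable R := by unfold R; fun_prop
  have hE0 : ∀ y, 0 ≤ E y := fun y =>
    add_nonneg zero_le_one (Set.indicator_nonneg (fun _ _ => by linarith) y)
  have hR0 : ∀ y, 0 ≤ R y := fun y =>
    div_nonneg (Finset.prod_nonneg fun i _ => hp.nonneg _)
      (Finset.prod_nonneg fun i _ => hp.nonneg _)
  have hEQ : Integrable E (noiseVec p n) :=
    (integrable_const 1).add ((integrable_const _).indicator hA)
  have hEQ1 : ∫ y, E y ∂(noiseVec p n) = 1 + (M - 1) * (noiseVec p n).real A := by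
    rw [integral_add (integrable_const 1) ((integrable_const _).indicator hA),
      integral_indicator hA]
    simp [mul_comm]
  have hcm : ∫⁻ y, ENNReal.ofReal (E y * R y) ∂(channelLaw p x) ≤
      ENNReal.ofReal (1 + (M - 1) * (noiseVec p n).real A) := by
    rw [← hEQ1, ofReal_integral_eq_lintegral_ofReal hEQ (ae_of_all _ hE0)]
    unfold channelLaw
    rw [lintegral_map (by fun_prop) hxm]
    refine le_trans (le_of_eq (lintegral_congr fun z => ?_))
      (lintegral_translate_mul_ratio_le hp hm x (F := fun y => ENNReal.ofReal (E y)) (by fun_prop))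
    rw [ENNReal.ofReal_mul (hE0 _)]
    simp [hR]
  have hI : Integrable (fun y => E y * R y) (channelLaw p x) := by
    refine ⟨(hEm.mul hRm).aestronglyMeasurable, ?_⟩
    rw [hasFiniteIntegral_iff_ofReal (ae_of_all _ fun y => mul_nonneg (hE0 y) (hR0 y))]
    exact hcm.trans_lt ENNReal.ofReal_lt_top
  have hI1 : ∫ y, E y * R y ∂(channelLaw p x) ≤ 1 + (M - 1) * (noiseVec p n).real A := by
    rw [integral_eq_lintegral_of_nonneg_ae (ae_of_all _ fun y => mul_nonneg (hE0 y) (hR0 y))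
      (hEm.mul hRm).aestronglyMeasurable]
    exact ENNReal.toReal_le_of_le_ofReal
      (add_nonneg zero_le_one (mul_nonneg (by linarith) measureReal_nonneg)) hcm
  have hL : Integrable (A.indicator fun _ => Real.log M) (channelLaw p x) :=
    (integrable_const _).indicator hA
  have i1 : Integrable (fun y => A.indicator (fun _ => Real.log M) y + excessSum p (y - x))
    (channelLaw p x) := hL.add hΓ
  have i2 : Integrable (fun y => A.indicator (fun _ => Real.log M) y + excessSum p (y - x)
    - E y * R y) (channelLaw p x) := i1.sub hI
  refine ⟨fun y => A.indicator (fun _ => Real.log M) y + excessSum p (y - x) - E y * R y + 1,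
    i2.add (integrable_const _), ?_, ?_⟩
  · have hpos : ∀ᵐ y ∂(channelLaw p x), 0 < ∏ i, p (y i - x i) := by
      unfold channelLaw
      rw [ae_map_iff hxm.aemeasurable (measurableSet_lt (by fun_prop) (by fun_prop))]
      simpa using ae_noiseVec_prod_pos hp hm n
    filter_upwards [hpos, hac.ae_le (ae_noiseVec_prod_pos hp hm n)] with y h1 h2
    rw [excessSum_eq_sub_log_prod p y h2, excessSum_eq_sub_log_prod p (y - x) h1]
    have hEexp : Real.exp (A.indicator (fun _ => Real.log M) y) = E y := by
      by_cases hy : y ∈ A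
      · simp [hE, hy, Real.exp_log (by linarith : 0 < M)]
      · simp [hE, hy]
    -- Since log R(y) = Γ(y - x) - Γ(y), this inequality is exactly the minorant of Γ(y).
    have h3 := Real.add_one_le_exp (A.indicator (fun _ => Real.log M) y + Real.log (R y))
    rw [Real.exp_add, hEexp, Real.exp_log (div_pos h2 h1), hR,
      Real.log_div h2.ne' h1.ne'] at h3
    simp only [Pi.sub_apply, hR] at h3 ⊢
    linarith
  · rw [integral_add i2 (integrable_const _), integral_sub i1 hI, integral_add hL hΓ, hΓ0,
      integral_indicator hA]
    simp
    linarith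

/-! ### Averaging over messages and keys. -/

lemma Code.isProbabilityMeasure_outputLaw {p : ℝ → ℝ} (hp : IsPDF p) {n M K : ℕ} (hM : 0 < M)
    (hK : 0 < K) (c : Code n M K) : IsProbabilityMeasure (c.outputLaw p) := by
  have := fun m k => hp.isProbabilityMeasure_channelLaw (c.enc m k)
  refine ⟨?_⟩
  simp only [Code.outputLaw, Measure.smul_apply, Measure.finsetSum_apply, measure_univ,
    Finset.sum_const, Finset.card_univ, Fintype.card_fin, smul_eq_mul, nsmul_eq_mul, mul_one]
  rw [mul_comm (M : ℝ≥0∞)]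
  exact ENNReal.inv_mul_cancel (by simp [hM.ne', hK.ne']) (by finiteness)

lemma Code.integral_outputLaw {p : ℝ → ℝ} {n M K : ℕ} (c : Code n M K) {f : (Fin n → ℝ) → ℝ}
    (hf : ∀ m k, Integrable f (channelLaw p (c.enc m k))) :
    ∫ y, f y ∂(c.outputLaw p) =
      ((K : ℝ) * M)⁻¹ * ∑ m, ∑ k, ∫ y, f y ∂(channelLaw p (c.enc m k)) := by
  unfold Code.outputLaw
  rw [integral_smul_measure, integral_finsetSum_measure fun m _ =>
    integrable_finsetSum_measure.2 fun k _ => hf m k]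
  simp only [smul_eq_mul]
  congr 1
  · simp
  · exact Finset.sum_congr rfl fun m _ => integral_finsetSum_measure fun k _ => hf m k

/-- Passes absolute continuity and integrability from the mixture to each codeword. -/
lemma Code.channelLaw_le {p : ℝ → ℝ} {n M K : ℕ} (c : Code n M K) (m : Fin M) (k : Fin K) :
    channelLaw p (c.enc m k) ≤ ((K : ℝ≥0∞) * M) • c.outputLaw p := by
  have hK : (K : ℝ≥0∞) * M ≠ 0 := by
    have := k.pos; have := m.pos
    simp; omega
  unfold Code.outputLaw
  rw [smul_smul, ENNReal.mul_inv_cancel hK (by finiteness), one_smul]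
  intro s
  simp only [Measure.finsetSum_apply]
  exact (Finset.single_le_sum (f := fun k => channelLaw p (c.enc m k) s)
    (fun _ _ => zero_le) (Finset.mem_univ k)).trans
    (Finset.single_le_sum (f := fun m => ∑ k, channelLaw p (c.enc m k) s)
    (fun _ _ => zero_le) (Finset.mem_univ m))

/-- The probability of correct decoding is at least `1 - ε`. -/
lemma Code.one_sub_le_avg_success {p : ℝ → ℝ} (hp : IsPDF p) {n M K : ℕ} (hM : 0 < M)
    (hK : 0 < K) (c : Code n M K) {ε : ℝ} (hε : 0 ≤ ε) (herr : c.avgError p ≤ ENNReal.ofReal ε) :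
    1 - ε ≤ ((K : ℝ) * M)⁻¹ *
      ∑ m, ∑ k, (channelLaw p (c.enc m k)).real {y | c.dec y k = m} := by
  have := fun m k => hp.isProbabilityMeasure_channelLaw (c.enc m k)
  have h1 : ∀ m k, (channelLaw p (c.enc m k)).real {y | c.dec y k = m} =
      1 - (channelLaw p (c.enc m k)).real {y | c.dec y k ≠ m} := fun m k => by
    have hms : MeasurableSet {y | c.dec y k = m} :=
      c.measurable_dec k (measurableSet_singleton m)
    have := probReal_compl_eq_one_sub (μ := channelLaw p (c.enc m k)) hms
    have h2 : {y | c.dec y k = m}ᶜ = {y | c.dec y k ≠ m} := rfl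
    rw [h2] at this
    linarith
  have h3 : ((K : ℝ) * M)⁻¹ *
      ∑ m, ∑ k, (channelLaw p (c.enc m k)).real {y | c.dec y k ≠ m} ≤ ε := by
    refine le_trans (le_of_eq ?_) (ENNReal.toReal_le_of_le_ofReal hε herr)
    unfold Code.avgError
    rw [ENNReal.toReal_mul, ENNReal.toReal_sum fun m _ =>
      ENNReal.sum_ne_top.2 fun k _ => measure_ne_top _ _]
    congr 1
    · simp
    · refine Finset.sum_congr rfl fun m _ => ?_
      rw [ENNReal.toReal_sum fun k _ => by finiteness]
      rfl
  simp_rw [h1, Finset.sum_sub_distrib, mul_sub]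
  simp only [Finset.sum_const, Finset.card_univ, Fintype.card_fin, nsmul_eq_mul, mul_one]
  rw [mul_comm (M : ℝ), inv_mul_cancel₀ (by positivity)]
  linarith

/-- Converse bound: covertness and reliability limit the number of messages. -/
lemma Code.one_sub_mul_log_le {p : ℝ → ℝ} (hp : IsPDF p) (hm : Measurable p)
    (hg : Integrable (excess p) (noise p)) (hg0 : ∫ z, excess p z ∂noise p = 0) {n M K : ℕ}
    (hM : 0 < M) (hK : 0 < K) (c : Code n M K) {Δ ε t b : ℝ} (hΔ : 0 ≤ Δ) (hε : 0 ≤ ε)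
    (ht : 0 < t) (hcov : c.IsCovert p Δ) (herr : c.avgError p ≤ ENNReal.ofReal ε)
    (hint : Integrable (fun z => Real.exp (t * excess p z)) (noise p))
    (hb : ∫ z, Real.exp (t * excess p z) ∂noise p ≤ Real.exp b) :
    (1 - ε) * Real.log M ≤ 1 + (Δ + n * b) / t := by
  have := hp.isProbabilityMeasure
  have := hp.isProbabilityMeasure_noiseVec n
  have := c.isProbabilityMeasure_outputLaw hp hM hK
  have hM1 : (1 : ℝ) ≤ M := by exact_mod_cast hM
  have hexpeq : ∀ y : Fin n → ℝ,
      Real.exp (t * excessSum p y) = ∏ i, Real.exp (t * excess p (y i)) := fun y => by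
    rw [excessSum, Finset.mul_sum, Real.exp_sum]
  have hacY : c.outputLaw p ≪ noiseVec p n :=
    (klDiv_ne_top_iff.1 (ne_top_of_le_ne_top ENNReal.ofReal_ne_top hcov)).1
  have hac : ∀ m k, channelLaw p (c.enc m k) ≪ noiseVec p n := fun m k =>
    (Measure.absolutelyContinuous_of_le_smul (c.channelLaw_le m k)).trans hacY
  obtain ⟨G, hGi, hG, hGb⟩ := exists_integrable_majorant_of_klDiv_le hΔ hcov
    (f := fun y => t * excessSum p y) (b := n * b) ((measurable_excessSum hm).const_mul t)
    (by simp_rw [hexpeq]; exact Integrable.fintype_prod fun _ => hint)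
    (by
      simp_rw [hexpeq]
      rw [noiseVec, integral_fintype_prod_eq_pow (fun z => Real.exp (t * excess p z)),
        Fintype.card_fin, Real.exp_nat_mul]
      exact pow_le_pow_left₀ (integral_nonneg fun z => (Real.exp_pos _).le) hb n)
  have hmin := fun m k => exists_integrable_minorant hp hm hg hg0 (c.enc m k) (hac m k)
    (A := {y | c.dec y k = m}) (c.measurable_dec k (measurableSet_singleton m)) hM1
  have hGi' : ∀ m k, Integrable G (channelLaw p (c.enc m k)) := fun m k =>
    (hGi.smul_measure (by finiteness)).mono_measure (c.channelLaw_le m k)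
  -- Inputs are arbitrary, so integrability of Γ is not automatic; it follows by squeezing Γ between
  -- the Fano minorant and the Donsker–Varadhan majorant.
  have hΓ : ∀ m k, Integrable (excessSum p) (channelLaw p (c.enc m k)) := fun m k => by
    obtain ⟨H, hHi, hH, -⟩ := hmin m k
    have hG' : ∀ᵐ y ∂(channelLaw p (c.enc m k)), excessSum p y ≤ t⁻¹ * G y := by
      filter_upwards [(Measure.absolutelyContinuous_of_le_smul (c.channelLaw_le m k)).ae_le hG]
        with y hy
      rw [inv_mul_eq_div, le_div_iff₀ ht, mul_comm]
      exact hy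
    exact integrable_of_le_of_le (measurable_excessSum hm).aestronglyMeasurable hH hG' hHi
      ((hGi' m k).const_mul _)
  have hlow : ∀ m k, (channelLaw p (c.enc m k)).real {y | c.dec y k = m} * Real.log M -
      (M - 1) * (noiseVec p n).real {y | c.dec y k = m} ≤
      ∫ y, excessSum p y ∂(channelLaw p (c.enc m k)) := fun m k => by
    obtain ⟨H, hHi, hH, hHb⟩ := hmin m k
    exact hHb.trans (integral_mono_ae hHi (hΓ m k) hH)
  have hup : ∫ y, excessSum p y ∂(c.outputLaw p) ≤ (Δ + n * b) / t := by
    have hΓY : Integrable (excessSum p) (c.outputLaw p) := by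
      unfold Code.outputLaw
      exact (integrable_finsetSum_measure.2 fun m _ => integrable_finsetSum_measure.2
        fun k _ => hΓ m k).smul_measure (by simp [hM.ne', hK.ne'])
    rw [le_div_iff₀ ht, mul_comm, ← integral_const_mul]
    exact (integral_mono_ae (hΓY.const_mul t) hGi hG).trans hGb
  -- For each key the decision regions partition the output space, so the Fano penalties average to
  -- (M - 1)/M ≤ 1.
  have hQ : ∑ m, ∑ k, (noiseVec p n).real {y | c.dec y k = m} = K := by
    rw [Finset.sum_comm]
    have : ∀ k, ∑ m, (noiseVec p n).real {y | c.dec y k = m} = 1 := fun k => by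
      have := sum_measureReal_preimage_singleton (μ := noiseVec p n) (f := fun y => c.dec y k)
        (Finset.univ : Finset (Fin M))
        (fun m _ => c.measurable_dec k (measurableSet_singleton m))
      simpa [Set.preimage, measureReal_def] using this
    simp [this]
  have hMK : 0 < (K : ℝ) * M := by positivity
  have hsum := Finset.sum_le_sum fun m (_ : m ∈ Finset.univ) =>
    Finset.sum_le_sum fun k (_ : k ∈ Finset.univ) => hlow m k
  rw [c.integral_outputLaw hΓ] at hup
  simp_rw [Finset.sum_sub_distrib, ← Finset.sum_mul, ← Finset.mul_sum] at hsum
  rw [hQ] at hsum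
  have hsucc := mul_le_mul_of_nonneg_right (c.one_sub_le_avg_success hp hM hK hε herr)
    (Real.log_nonneg hM1)
  have h5 := mul_le_mul_of_nonneg_left hsum (inv_pos.2 hMK).le
  have h6 : ((K : ℝ) * M)⁻¹ * ((M - 1) * K) ≤ 1 := by
    rw [inv_mul_le_iff₀ hMK]
    nlinarith [(Nat.cast_pos (α := ℝ)).2 hK]
  rw [mul_sub, ← mul_assoc] at h5
  linarith

/-! ### Moments of the self-information. -/

lemma integrable_noise_iff {p : ℝ → ℝ} (hp : IsPDF p) (hm : Measurable p) {f : ℝ → ℝ} :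
    Integrable f (noise p) ↔ Integrable (fun z => p z * f z) volume := by
  unfold noise
  rw [integrable_withDensity_iff (by fun_prop) (ae_of_all _ fun z => ENNReal.ofReal_lt_top)]
  simp only [ENNReal.toReal_ofReal (hp.nonneg _), mul_comm]

/-- Turns the hypotheses on p^ζ into exponential moments of -ln p(Z) at τ = 1 - ζ. -/
lemma mul_exp_neg_mul_log {a : ℝ} (ha : 0 ≤ a) {ζ : ℝ} (hζ : 0 < ζ) :
    a * Real.exp ((1 - ζ) * -Real.log a) = a ^ ζ := by
  rcases ha.eq_or_lt with h | h
  · simp [← h, Real.zero_rpow hζ.ne']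
  · rw [Real.rpow_def_of_pos h]
    nth_rewrite 1 [← Real.exp_log h]
    rw [← Real.exp_add]
    congr 1; ring

lemma sub_pow_four_le (c l : ℝ) : (c - l) ^ 4 ≤ 8 * c ^ 4 + 8 * l ^ 4 := by
  nlinarith [sq_nonneg (c + l), sq_nonneg (c - l), sq_nonneg (c ^ 2 - l ^ 2),
    sq_nonneg (c ^ 2 + l ^ 2 - 2 * c * l - (c + l) ^ 2),
    mul_nonneg (sq_nonneg (c + l)) (sq_nonneg (c - l)),
    mul_nonneg (sq_nonneg (c + l)) (sq_nonneg (c + l))]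

lemma abs_pow_le_one_add_pow_four (a : ℝ) {k : ℕ} (hk : k ≤ 4) : |a| ^ k ≤ 1 + a ^ 4 := by
  have h4 : a ^ 4 = |a| ^ 4 := by rw [pow_abs, abs_of_nonneg (by positivity)]
  rw [h4]
  rcases le_total |a| 1 with h | h
  · have := pow_le_one₀ (n := k) (abs_nonneg a) h
    have : 0 ≤ |a| ^ 4 := by positivity
    linarith
  · have := pow_le_pow_right₀ h hk
    linarith

lemma integrable_abs_sub_pow_mul {α : Type*} [MeasurableSpace α] {μ : Measure α} {l φ : α → ℝ}
    (hl : Measurable l) (hφm : Measurable φ) (hφ0 : ∀ a, 0 ≤ φ a) (hφ : Integrable φ μ)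
    (hφl : Integrable (fun a => l a ^ 4 * φ a) μ) (c : ℝ) {k : ℕ} (hk : k ≤ 4) :
    Integrable (fun a => |c - l a| ^ k * φ a) μ := by
  refine ((hφ.const_mul (1 + 8 * c ^ 4)).add (hφl.const_mul 8)).mono'
    (by fun_prop) (ae_of_all _ fun a => ?_)
  rw [Real.norm_of_nonneg (mul_nonneg (by positivity) (hφ0 a))]
  have h1 := mul_le_mul_of_nonneg_right ((abs_pow_le_one_add_pow_four (c - l a) hk).trans
    (add_le_add_right (sub_pow_four_le c (l a)) 1)) (hφ0 a)
  simp only [Pi.add_apply]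
  linarith

lemma integrable_abs_excess_pow {p : ℝ → ℝ} (hp : IsPDF p) (hm : Measurable p)
    (h0 : Integrable (fun z => p z * Real.log (p z) ^ 4) volume) (c : ℝ) {k : ℕ} (hk : k ≤ 4) :
    Integrable (fun z => |c - Real.log (p z)| ^ k) (noise p) := by
  have := hp.isProbabilityMeasure
  have := integrable_abs_sub_pow_mul (μ := noise p) (l := fun z => Real.log (p z))
    (φ := fun _ => 1) (by fun_prop) (by fun_prop) (by simp) (integrable_const 1)
    (by simpa using (integrable_noise_iff hp hm).2 h0) c hk
  simpa using this

lemma integrable_log {p : ℝ → ℝ} (hp : IsPDF p) (hm : Measurable p)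
    (h0 : Integrable (fun z => p z * Real.log (p z) ^ 4) volume) :
    Integrable (fun z => Real.log (p z)) (noise p) := by
  have := integrable_abs_excess_pow hp hm h0 0 (k := 1) (by norm_num)
  refine (integrable_norm_iff (Measurable.aestronglyMeasurable (by fun_prop))).1 ?_
  simpa using this

lemma integrable_excess {p : ℝ → ℝ} (hp : IsPDF p) (hm : Measurable p)
    (h0 : Integrable (fun z => p z * Real.log (p z) ^ 4) volume) :
    Integrable (excess p) (noise p) := by
  have := hp.isProbabilityMeasure
  exact (integrable_const _).sub (integrable_log hp hm h0)

lemma integral_excess {p : ℝ → ℝ} (hp : IsPDF p) (hm : Measurable p)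
    (h0 : Integrable (fun z => p z * Real.log (p z) ^ 4) volume) :
    ∫ z, excess p z ∂noise p = 0 := by
  have := hp.isProbabilityMeasure
  unfold excess
  rw [integral_sub (integrable_const _) (integrable_log hp hm h0)]
  simp

lemma integrable_excess_sq {p : ℝ → ℝ} (hp : IsPDF p) (hm : Measurable p)
    (h0 : Integrable (fun z => p z * Real.log (p z) ^ 4) volume) :
    Integrable (fun z => excess p z ^ 2) (noise p) := by
  simpa only [sq_abs, excess] using
    integrable_abs_excess_pow hp hm h0 (∫ w, Real.log (p w) ∂noise p) (k := 2) (by norm_num)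

lemma integral_excess_sq {p : ℝ → ℝ} (hm : Measurable p) :
    ∫ z, excess p z ^ 2 ∂noise p = variance (fun z => Real.log (p z)) (noise p) := by
  rw [variance_eq_integral (by fun_prop)]
  refine integral_congr_ae (ae_of_all _ fun z => ?_)
  simp only [excess]
  ring

lemma integrable_exp_neg_log {p : ℝ → ℝ} (hp : IsPDF p) (hm : Measurable p)
    {ζ : ℝ} (hζ0 : 0 < ζ) (h1 : Integrable (fun z => p z ^ ζ) volume) :
    Integrable (fun z => Real.exp ((1 - ζ) * -Real.log (p z))) (noise p) := by
  rw [integrable_noise_iff hp hm]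
  simpa only [mul_exp_neg_mul_log (hp.nonneg _) hζ0] using h1

lemma integrable_exp_excess {p : ℝ → ℝ} (hp : IsPDF p) (hm : Measurable p)
    {ζ : ℝ} (hζ0 : 0 < ζ) (h1 : Integrable (fun z => p z ^ ζ) volume) :
    Integrable (fun z => Real.exp ((1 - ζ) * excess p z)) (noise p) := by
  have := (integrable_exp_neg_log hp hm hζ0 h1).const_mul
    (Real.exp ((1 - ζ) * ∫ w, Real.log (p w) ∂noise p))
  simpa only [excess, ← Real.exp_add, ← mul_add, ← sub_eq_add_neg] using this

lemma integrable_excess_cube_mul {p : ℝ → ℝ} (hp : IsPDF p) (hm : Measurable p)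
    (h0 : Integrable (fun z => p z * Real.log (p z) ^ 4) volume)
    {ζ : ℝ} (hζ0 : 0 < ζ) (h1 : Integrable (fun z => p z ^ ζ) volume)
    (h2 : Integrable (fun z => p z ^ ζ * Real.log (p z) ^ 4) volume) :
    Integrable (fun z => |excess p z| ^ 3 * (1 + Real.exp ((1 - ζ) * excess p z))) (noise p) := by
  have := integrable_abs_sub_pow_mul (μ := noise p) (l := fun z => Real.log (p z))
    (φ := fun z => Real.exp ((1 - ζ) * -Real.log (p z))) (by fun_prop) (by fun_prop)
    (fun z => (Real.exp_pos _).le) (integrable_exp_neg_log hp hm hζ0 h1)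
    (by
      rw [integrable_noise_iff hp hm]
      refine h2.congr (ae_of_all _ fun z => ?_)
      simp only [← mul_exp_neg_mul_log (hp.nonneg z) hζ0]
      ring) (∫ w, Real.log (p w) ∂noise p) (k := 3) (by norm_num)
  have hA := this.const_mul (Real.exp ((1 - ζ) * ∫ w, Real.log (p w) ∂noise p))
  have hB := integrable_abs_excess_pow hp hm h0 (∫ w, Real.log (p w) ∂noise p) (k := 3)
    (by norm_num)
  refine (hB.add hA).congr (ae_of_all _ fun z => ?_)
  simp only [Pi.add_apply, excess, sub_eq_add_neg, mul_add, Real.exp_add]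
  ring

/-! ### Existence of the limit and its nonnegativity. -/

lemma scalingAt_congr {p q : ℝ → ℝ} (h : noise p = noise q) : scalingAt p = scalingAt q := by
  have h1 : ∀ n, noiseVec p n = noiseVec q n := fun n => by simp only [noiseVec, h]
  have h2 : ∀ {n : ℕ} (x : Fin n → ℝ), channelLaw p x = channelLaw q x := fun x => by
    simp only [channelLaw, h1]
  funext Δ ε
  simp only [scalingAt, maxLogMessages, Code.IsCovert, Code.avgError, Code.outputLaw, h1, h2]

lemma maxLogMessages_mono (p : ℝ → ℝ) (Δ : ℝ) (n : ℕ) :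
    Monotone fun ε => maxLogMessages p Δ ε n := by
  intro ε ε' h
  refine sSup_le_sSup ?_
  rintro a ⟨M, K, hM, hK, ha, c, hc, hce⟩
  exact ⟨M, K, hM, hK, ha, c, hc, hce.trans (ENNReal.ofReal_le_ofReal h)⟩

lemma scalingAt_mono (p : ℝ → ℝ) (Δ : ℝ) : Monotone (scalingAt p Δ) := fun _ _ h =>
  liminf_le_liminf (Eventually.of_forall fun n =>
    EReal.div_le_div_right_of_nonneg (EReal.coe_nonneg.2 (Real.sqrt_nonneg _))
      (maxLogMessages_mono p Δ n h))

/-- A monotone function into the complete order `EReal` has a right limit, so `limUnder` is a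
genuine limit. -/
lemma tendsto_scalingAt (p : ℝ → ℝ) (Δ : ℝ) :
    Tendsto (fun ε => scalingAt p Δ ε) (𝓝[>] (0 : ℝ)) (𝓝 (scalingConstant p Δ)) :=
  tendsto_nhds_limUnder ⟨_, (scalingAt_mono p Δ).tendsto_nhdsGT 0⟩

lemma maxLogMessages_nonneg {p : ℝ → ℝ} (hp : IsPDF p) (Δ ε : ℝ) (n : ℕ) :
    0 ≤ maxLogMessages p Δ ε n := by
  have := hp.isProbabilityMeasure_noiseVec n
  -- One message, sent as the zero word: no error, and the output is pure noise.
  refine le_sSup ⟨1, 1, one_pos, one_pos, by simp, ⟨fun _ _ => 0, fun _ _ => 0, fun _ =>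
    measurable_const⟩, ?_, ?_⟩
  · simp [Code.IsCovert, Code.outputLaw, channelLaw]
  · simp [Code.avgError]

lemma scalingAt_nonneg {p : ℝ → ℝ} (hp : IsPDF p) (Δ ε : ℝ) : 0 ≤ scalingAt p Δ ε :=
  le_liminf_of_le (by isBoundedDefault) (Eventually.of_forall fun n =>
    EReal.div_nonneg (maxLogMessages_nonneg hp Δ ε n) (EReal.coe_nonneg.2 (Real.sqrt_nonneg _)))

lemma scalingConstant_nonneg {p : ℝ → ℝ} (hp : IsPDF p) (Δ : ℝ) : 0 ≤ scalingConstant p Δ :=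
  ge_of_tendsto' (tendsto_scalingAt p Δ) fun ε => scalingAt_nonneg hp Δ ε

/-! ### Asymptotics of the converse and optimisation over s. -/

lemma maxLogMessages_le {p : ℝ → ℝ} (hp : IsPDF p) (hm : Measurable p)
    (hg : Integrable (excess p) (noise p)) (hg0 : ∫ z, excess p z ∂noise p = 0)
    {Δ ε t b : ℝ} (hΔ : 0 ≤ Δ) (hε : 0 ≤ ε) (hε1 : ε < 1) (ht : 0 < t)
    (hint : Integrable (fun z => Real.exp (t * excess p z)) (noise p))
    (hb : ∫ z, Real.exp (t * excess p z) ∂noise p ≤ Real.exp b) (n : ℕ) :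
    maxLogMessages p Δ ε n ≤ (((1 + (Δ + n * b) / t) / (1 - ε) : ℝ) : EReal) := by
  refine sSup_le ?_
  rintro a ⟨M, K, hM, hK, rfl, c, hc, hce⟩
  rw [EReal.coe_le_coe_iff, le_div_iff₀ (by linarith), mul_comm]
  exact c.one_sub_mul_log_le hp hm hg hg0 hM hK hΔ hε ht hc hce hint hb

lemma tendsto_sqrt_natCast_mul {Δ : ℝ} (hΔ : 0 < Δ) :
    Tendsto (fun n : ℕ => √(n * Δ)) atTop atTop :=
  Real.tendsto_sqrt_atTop.comp (tendsto_natCast_atTop_atTop.atTop_mul_const hΔ)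

lemma tendsto_sqrt_natCast_mul_div {Δ : ℝ} (hΔ : 0 < Δ) :
    Tendsto (fun n : ℕ => √(n * Δ) / n) atTop (𝓝 0) := by
  have h : Tendsto (fun n : ℕ => Δ / √(n * Δ)) atTop (𝓝 0) :=
    tendsto_const_nhds.div_atTop (tendsto_sqrt_natCast_mul hΔ)
  refine h.congr' ?_
  filter_upwards [eventually_gt_atTop 0] with n hn
  have hn' : (0 : ℝ) < n := by exact_mod_cast hn
  have hq : 0 < √(n * Δ) := Real.sqrt_pos.2 (by positivity)
  rw [div_eq_div_iff hq.ne' hn'.ne', Real.mul_self_sqrt (by positivity), mul_comm]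

lemma scalingAt_le {p : ℝ → ℝ} (hp : IsPDF p) (hm : Measurable p) {ζ : ℝ} (hζ0 : 0 < ζ)
    (hζ1 : ζ < 1) (h0 : Integrable (fun z => p z * Real.log (p z) ^ 4) volume)
    (h1 : Integrable (fun z => p z ^ ζ) volume)
    (h2 : Integrable (fun z => p z ^ ζ * Real.log (p z) ^ 4) volume)
    {Δ ε s : ℝ} (hΔ : 0 < Δ) (hε : 0 ≤ ε) (hε1 : ε < 1) (hs : 0 < s) :
    scalingAt p Δ ε ≤
      (((1 / s + s / 2 * variance (fun z => Real.log (p z)) (noise p)) / (1 - ε) : ℝ) : EReal) := by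
  have := hp.isProbabilityMeasure
  set V := variance (fun z => Real.log (p z)) (noise p) with hV
  set C := ∫ z, |excess p z| ^ 3 * (1 + Real.exp ((1 - ζ) * excess p z)) ∂noise p with hC
  have hlim : Tendsto (fun n : ℕ => (1 / √(n * Δ) + 1 / s + s / 2 * V + s ^ 2 * C *
      (√(n * Δ) / n)) / (1 - ε)) atTop
      (𝓝 ((0 + 1 / s + s / 2 * V + s ^ 2 * C * 0) / (1 - ε))) := by
    refine Tendsto.div_const (Tendsto.add (Tendsto.add (Tendsto.add ?_ tendsto_const_nhds)
      tendsto_const_nhds) ((tendsto_sqrt_natCast_mul_div hΔ).const_mul _)) _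
    exact tendsto_const_nhds.div_atTop (tendsto_sqrt_natCast_mul hΔ)
  rw [zero_add, mul_zero, add_zero] at hlim
  rw [← (EReal.tendsto_coe.2 hlim).liminf_eq]
  refine liminf_le_liminf ?_
  -- The tilt t = s√(nΔ)/n tends to 0, so it eventually lies in the range [0, 1 - ζ] of the moment
  -- bound.
  have hsmall : ∀ᶠ n : ℕ in atTop, s * (√(n * Δ) / n) < 1 - ζ := by
    have := (tendsto_sqrt_natCast_mul_div hΔ).const_mul s
    rw [mul_zero] at this
    exact this.eventually_lt_const (by linarith)
  filter_upwards [eventually_gt_atTop 0, hsmall] with n hn hnt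
  have hn' : (0 : ℝ) < n := by exact_mod_cast hn
  set q := √(n * Δ) with hq
  have hq0 : 0 < q := Real.sqrt_pos.2 (by positivity)
  have hqq : q ^ 2 = n * Δ := Real.sq_sqrt (by positivity)
  have ht0 : 0 < s * (q / n) := by positivity
  obtain ⟨hint, hb⟩ := integral_exp_mul_le ht0.le hnt.le (integrable_excess hp hm h0)
    (integral_excess hp hm h0) (integrable_excess_sq hp hm h0)
    (integrable_exp_excess hp hm hζ0 h1) (integrable_excess_cube_mul hp hm h0 hζ0 h1 h2)
  rw [integral_excess_sq hm, ← hV, ← hC] at hb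
  have hA := maxLogMessages_le hp hm (integrable_excess hp hm h0) (integral_excess hp hm h0)
    hΔ.le hε hε1 ht0 hint hb n
  refine (EReal.div_le_div_right_of_nonneg (EReal.coe_nonneg.2 hq0.le) hA).trans (le_of_eq ?_)
  rw [← EReal.coe_div]
  congr 1
  have hΔq : Δ = q ^ 2 / n := by rw [hqq]; field_simp
  have hε' : 1 - ε ≠ 0 := by linarith
  rw [hΔq]
  field_simp
  ring

lemma scalingConstant_le_of_forall_scalingAt_le {p : ℝ → ℝ} {Δ B : ℝ}
    (h : ∀ ε : ℝ, 0 ≤ ε → ε < 1 → scalingAt p Δ ε ≤ ((B / (1 - ε) : ℝ) : EReal)) :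
    scalingConstant p Δ ≤ (B : EReal) := by
  have hlim : Tendsto (fun ε : ℝ => B / (1 - ε)) (𝓝[>] 0) (𝓝 (B / (1 - 0))) :=
    (tendsto_const_nhds.div (tendsto_const_nhds.sub tendsto_id) (by norm_num)).mono_left
      nhdsWithin_le_nhds
  rw [sub_zero, div_one] at hlim
  refine le_of_tendsto_of_tendsto (tendsto_scalingAt p Δ) (EReal.tendsto_coe.2 hlim) ?_
  filter_upwards [Ioo_mem_nhdsGT (zero_lt_one' ℝ)] with ε hε
  exact h ε hε.1.le hε.2

lemma le_sqrt_two_mul_sqrt_of_forall {L : EReal} {V : ℝ} (hV : 0 ≤ V)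
    (h : ∀ s : ℝ, 0 < s → L ≤ ((1 / s + s / 2 * V : ℝ) : EReal)) :
    L ≤ ((√2 * √V : ℝ) : EReal) := by
  rcases hV.eq_or_lt with h0 | h0
  -- With V = 0 the infimum is not attained; s → ∞.
  · have hlim : Tendsto (fun s : ℝ => 1 / s) atTop (𝓝 0) :=
      tendsto_const_nhds.div_atTop tendsto_id
    have := ge_of_tendsto (EReal.tendsto_coe.2 hlim) ((eventually_gt_atTop 0).mono fun s hs => by
      simpa [← h0] using h s hs)
    simpa [← h0] using this
  · have hv : 0 < √V := Real.sqrt_pos.2 h0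
    have h2 : 0 < √(2 : ℝ) := by positivity
    -- The minimiser of 1/s + sV/2.
    refine (h (√2 / √V) (by positivity)).trans (le_of_eq ?_)
    congr 1
    nth_rewrite 3 [← Real.sq_sqrt hV]
    have h22 : √(2 : ℝ) ^ 2 = 2 := Real.sq_sqrt (by norm_num)
    field_simp
    linarith

/-- The upper bound on the scaling constant, for a Borel density. -/
lemma scalingConstant_le_of_measurable {p : ℝ → ℝ} (hp : IsPDF p) (hm : Measurable p) {ζ : ℝ}
    (hζ0 : 0 < ζ) (hζ1 : ζ < 1) (h0 : Integrable (fun z => p z * Real.log (p z) ^ 4) volume)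
    (h1 : Integrable (fun z => p z ^ ζ) volume)
    (h2 : Integrable (fun z => p z ^ ζ * Real.log (p z) ^ 4) volume) {Δ : ℝ} (hΔ : 0 < Δ) :
    scalingConstant p Δ ≤
      ((√2 * √(variance (fun z => Real.log (p z)) (noise p)) : ℝ) : EReal) :=
  le_sqrt_two_mul_sqrt_of_forall (variance_nonneg _ _) fun _ hs =>
    scalingConstant_le_of_forall_scalingAt_le fun _ hε hε1 =>
      scalingAt_le hp hm hζ0 hζ1 h0 h1 h2 hΔ hε hε1 hs

/-! ### Almost-everywhere versions of the density, and the uniform case. -/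

/-- Every density agrees almost everywhere with a Borel density. -/
lemma IsPDF.exists_measurable {p : ℝ → ℝ} (hp : IsPDF p) :
    ∃ q : ℝ → ℝ, Measurable q ∧ IsPDF q ∧ p =ᵐ[volume] q := by
  have hpq : p =ᵐ[volume] fun z => max (hp.aemeasurable.mk p z) 0 := by
    filter_upwards [hp.aemeasurable.ae_eq_mk] with z hz
    rw [← hz, max_eq_left (hp.nonneg z)]
  have hm : Measurable fun z => max (hp.aemeasurable.mk p z) 0 :=
    hp.aemeasurable.measurable_mk.max measurable_const
  refine ⟨_, hm, ⟨hm.aemeasurable, fun z => le_max_right _ _, ?_⟩, hpq⟩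
  rw [← hp.lintegral_eq_one]
  exact lintegral_congr_ae (hpq.symm.fun_comp ENNReal.ofReal)

lemma noise_absolutelyContinuous (p : ℝ → ℝ) : noise p ≪ volume :=
  withDensity_absolutelyContinuous _ _

lemma scalingConstant_le {p : ℝ → ℝ} (hp : IsPDF p) {ζ : ℝ}
    (hζ0 : 0 < ζ) (hζ1 : ζ < 1) (h0 : Integrable (fun z => p z * Real.log (p z) ^ 4) volume)
    (h1 : Integrable (fun z => p z ^ ζ) volume)
    (h2 : Integrable (fun z => p z ^ ζ * Real.log (p z) ^ 4) volume) {Δ : ℝ} (hΔ : 0 < Δ) :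
    scalingConstant p Δ ≤
      ((√2 * √(variance (fun z => Real.log (p z)) (noise p)) : ℝ) : EReal) := by
  obtain ⟨q, hqm, hq, hpq⟩ := hp.exists_measurable
  have hnoise : noise p = noise q :=
    withDensity_congr_ae (hpq.fun_comp ENNReal.ofReal)
  have hvar : variance (fun z => Real.log (p z)) (noise p) =
      variance (fun z => Real.log (q z)) (noise q) := by
    rw [← hnoise]
    exact variance_congr ((noise_absolutelyContinuous p).ae_le (hpq.fun_comp Real.log))
  have hsc : scalingConstant p Δ = scalingConstant q Δ := by
    simp only [scalingConstant, scalingAt_congr hnoise]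
  rw [hvar, hsc]
  exact scalingConstant_le_of_measurable hq hqm hζ0 hζ1
    (h0.congr (hpq.fun_comp fun a => a * Real.log a ^ 4))
    (h1.congr (hpq.fun_comp fun a => a ^ ζ))
    (h2.congr (hpq.fun_comp fun a => a ^ ζ * Real.log a ^ 4)) hΔ

/-- The noise lives on S, where ln p is almost everywhere constant. -/
lemma variance_log_uniform {p : ℝ → ℝ} (hp : IsPDF p) {S : Set ℝ}
    (hS : MeasurableSet S) (h : p =ᵐ[volume] S.indicator fun _ => (volume.real S)⁻¹) :
    variance (fun z => Real.log (p z)) (noise p) = 0 := by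
  have := hp.isProbabilityMeasure
  have hind : Measurable (S.indicator fun _ : ℝ => (volume.real S)⁻¹) :=
    measurable_const.indicator hS
  have hnoise : noise p = noise (S.indicator fun _ => (volume.real S)⁻¹) :=
    withDensity_congr_ae (h.fun_comp ENNReal.ofReal)
  have hconst : (fun z => Real.log (p z)) =ᵐ[noise p] fun _ => Real.log (volume.real S)⁻¹ := by
    have h1 : ∀ᵐ z ∂noise p, z ∈ S := by
      rw [hnoise]
      unfold noise
      rw [ae_withDensity_iff (by fun_prop)]
      refine ae_of_all _ fun z hz => ?_
      by_contra hzS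
      simp [hzS] at hz
    filter_upwards [h1, (noise_absolutelyContinuous p).ae_le h] with z hz hz'
    rw [hz', Set.indicator_of_mem hz]
  rw [variance_congr hconst, variance_eq_integral (by fun_prop)]
  simp

end CovertComm

theorem theorem1 (p : ℝ → ℝ) (hp : CovertComm.IsPDF p) (ζ : ℝ) (hζ0 : 0 < ζ) (hζ1 : ζ < 1)
    (h0 : Integrable (fun z => p z * Real.log (p z) ^ 4) volume)
    (h1 : Integrable (fun z => p z ^ ζ) volume)
    (h2 : Integrable (fun z => p z ^ ζ * Real.log (p z) ^ 4) volume)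
    (Δ : ℝ) (hΔ : 0 < Δ) :
    Tendsto (fun ε => CovertComm.scalingAt p Δ ε) (𝓝[>] (0 : ℝ))
        (𝓝 (CovertComm.scalingConstant p Δ)) ∧
      CovertComm.scalingConstant p Δ ≤
        ((Real.sqrt 2 * Real.sqrt (variance (fun z => Real.log (p z)) (CovertComm.noise p)) : ℝ)
          : EReal) ∧
      ∀ S : Set ℝ, MeasurableSet S →
        p =ᵐ[volume] S.indicator (fun _ => (volume.real S)⁻¹) →
        CovertComm.scalingConstant p Δ = 0 := by
  have hle := CovertComm.scalingConstant_le hp hζ0 hζ1 h0 h1 h2 hΔ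
  refine ⟨CovertComm.tendsto_scalingAt p Δ, hle, fun S hS hpS => ?_⟩
  rw [CovertComm.variance_log_uniform hp hS hpS] at hle
  exact le_antisymm (by simpa using hle) (CovertComm.scalingConstant_nonneg hp Δ)
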